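/- Let $L^2$ be the space of square-integrable functions on the unit circle $\mathbb T$ with normalized Lebesgue measure, and let $H^2\subset L^2$ be the Hardy space, i.e. the functions whose Fourier coefficients of negative index vanish. An inner function is a function in $H^2$ that is unimodular a.e. on $\mathbb T$; an inner function $\delta$ divides an inner function $\theta$ if $\theta/\delta$ is inner. For an inner function $\theta$ let $K_\theta=H^2\ominus\theta H^2$ (so $K_\theta=\{0\}$ if $\theta$ is constant), let $P_\theta$ be the orthogonal projection of $L^2$ onto $K_\theta$, and let $S_\theta f=P_\theta(zf)$, $f\in K_\theta$, be the compressed shift on $K_\theta$. For inner functions $\theta,\alpha$ and $\varphi\in L^2$ let $A_\varphi^{\theta,\alpha}$ be the operator $f\mapsto P_\alpha(\varphi f)$ defined on $K_\theta\cap L^\infty$. A bounded linear operator $A:K_\theta\to K_\alpha$ that extends $A_\varphi^{\theta,\alpha}$ is called an asymmetric truncated Toeplitz operator with symbol $\varphi$, and one writes $A=A_\varphi^{\theta,\alpha}$; the set of all such operators, $\varphi\in L^2$, is denoted by $\mathcal T(K_\theta,K_\alpha)$. Theorem. Let $\alpha,\theta$ be nonconstant inner functions and let $A:K_\theta\to K_\alpha$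 be a bounded linear operator. A greatest common divisor $\gcd(\alpha,\theta)$ of $\alpha$ and $\theta$ among inner functions exists, and for each choice of it (it is determined up to a unimodular constant factor) one has $$S_\alpha A=AS_\theta$$ if and only if $A\in\mathcal T(K_\theta,K_\alpha)$ and $A=A_\varphi^{\theta,\alpha}$ for some $\varphi\in\frac{\alpha}{\gcd(\alpha,\theta)}K_{\gcd(\alpha,\theta)}$. -/

import Mathlib

open MeasureTheory
open scoped ENNReal

noncomputable section

namespace ModelSpace

/-- Normalized Lebesgue measure `m` on the unit circle. The circle is parametrized as `ℝ/ℤ` by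
`t ↦ exp (2πit)`; the function `fourier n` is then `z ↦ z ^ n`. -/
abbrev m : Measure UnitAddCircle := AddCircle.haarAddCircle

/-- The space `L²` of the unit circle. -/
abbrev L2 : Type := Lp ℂ 2 m

/-- The Hardy space `H²`, as a space of boundary functions: the elements of `L²` whose Fourier
coefficients of negative index vanish. -/
def H2 : Submodule ℂ L2 where
  carrier := {f | ∀ n : ℤ, n < 0 → fourierCoeff f n = 0}
  zero_mem' n _ := by rw [← fourierBasis_repr]; simp
  add_mem' {f g} hf hg n hn := by
    have hf' := hf n hn
    have hg' := hg n hn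
    rw [← fourierBasis_repr] at hf' hg' ⊢
    simp [hf', hg']
  smul_mem' c f hf n hn := by
    have hf' := hf n hn
    rw [← fourierBasis_repr] at hf' ⊢
    simp [hf']

theorem isClosed_H2 : IsClosed (H2 : Set L2) := by
  have h : (H2 : Set L2) = ⋂ n : ℤ, ⋂ _ : n < 0,
      {f : L2 | inner ℂ (fourierBasis (T := 1) n) f = 0} := by
    ext f
    simp only [H2, Submodule.coe_set_mk, AddSubmonoid.coe_set_mk, AddSubsemigroup.coe_set_mk,
      Set.mem_ofPred_eq, Set.mem_iInter]
    refine forall₂_congr fun n _ => ?_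
    rw [← fourierBasis_repr, HilbertBasis.repr_apply_apply]
  rw [h]
  exact isClosed_iInter fun n => isClosed_iInter fun _ =>
    isClosed_eq (continuous_const.inner continuous_id) continuous_const

/-- Inner functions, as boundary functions: elements of `H²` (hence of `H^∞`) which are
unimodular almost everywhere on the circle. -/
def IsInner (θ : L2) : Prop :=
  θ ∈ H2 ∧ ∀ᵐ x ∂m, ‖θ x‖ = 1

/-- `θ` is constant (as an equivalence class of functions). -/
def IsConst (θ : L2) : Prop :=
  ∃ c : ℂ, ∀ᵐ x ∂m, θ x = c

/-- The inner function `α` divides `θ`: the quotient `θ / α` is an inner function. -/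
def InnerDvd (α θ : L2) : Prop :=
  ∃ δ : L2, IsInner δ ∧ ∀ᵐ x ∂m, θ x = α x * δ x

/-- `γ` is a greatest common divisor of the inner functions `α` and `θ`. -/
def IsInnerGCD (γ α θ : L2) : Prop :=
  IsInner γ ∧ InnerDvd γ α ∧ InnerDvd γ θ ∧
    ∀ δ : L2, IsInner δ → InnerDvd δ α → InnerDvd δ θ → InnerDvd δ γ

/-- The subspace `θ H²`. -/
def mulH2 (θ : L2) : Submodule ℂ L2 where
  carrier := {f | ∃ h ∈ H2, ∀ᵐ x ∂m, f x = θ x * h x}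
  zero_mem' := ⟨0, H2.zero_mem, by
    filter_upwards [Lp.coeFn_zero ℂ 2 m] with x hx
    rw [hx]
    exact (mul_zero _).symm⟩
  add_mem' := by
    rintro f g ⟨h, hh, hf⟩ ⟨k, hk, hg⟩
    refine ⟨h + k, H2.add_mem hh hk, ?_⟩
    filter_upwards [hf, hg, Lp.coeFn_add f g, Lp.coeFn_add h k] with x h1 h2 h3 h4
    rw [h3, h4, Pi.add_apply, Pi.add_apply, h1, h2, mul_add]
  smul_mem' := by
    rintro c f ⟨h, hh, hf⟩
    refine ⟨c • h, H2.smul_mem c hh, ?_⟩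
    filter_upwards [hf, Lp.coeFn_smul c f, Lp.coeFn_smul c h] with x h1 h2 h3
    rw [h2, h3, Pi.smul_apply, Pi.smul_apply, h1, smul_eq_mul, smul_eq_mul, mul_left_comm]

/-- The model space `K_θ = H² ⊖ θ H²`. -/
def K (θ : L2) : Submodule ℂ L2 := H2 ⊓ (mulH2 θ)ᗮ

instance completeSpace_K (θ : L2) : CompleteSpace (K θ) :=
  (isClosed_H2.inter (Submodule.isClosed_orthogonal (mulH2 θ))).completeSpace_coe

/-- The orthogonal projection `P_θ` of `L²` onto `K_θ`. -/
def P (θ : L2) : L2 →L[ℂ] K θ := (K θ).orthogonalProjectionOnto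

/-- Multiplication by the independent variable `z` on `L²`. -/
def mulZ : L2 →L[ℂ] L2 :=
  (ContinuousLinearMap.mul ℂ ℂ).holderL m ∞ 2 2 (fourierLp ∞ 1)

theorem coeFn_mulZ (f : L2) : ∀ᵐ x ∂m, mulZ f x = fourier 1 x * f x := by
  have h := (ContinuousLinearMap.mul ℂ ℂ).coeFn_holder (r := 2) (fourierLp (T := 1) ∞ 1) f
  filter_upwards [h, coeFn_fourierLp (T := 1) ∞ 1] with x h1 h2
  rw [← h2]
  exact h1

/-- The compressed shift `S_θ = P_θ M_z | K_θ`. -/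
def S (θ : L2) : K θ →L[ℂ] K θ := P θ ∘L mulZ ∘L (K θ).subtypeL

/-- The (in general unbounded) multiplication operator `M_φ` on `L²`, with domain
`{f ∈ L² : φ f ∈ L²}`. -/
def M (φ : L2) : L2 →ₗ.[ℂ] L2 where
  domain :=
    { carrier := {f | MemLp (fun x => φ x * f x) 2 m}
      zero_mem' := by
        refine (memLp_congr_ae ?_).mpr (MemLp.zero (ε := ℂ))
        filter_upwards [Lp.coeFn_zero ℂ 2 m] with x hx
        rw [hx]
        exact mul_zero _
      add_mem' := by
        intro f g hf hg
        refine (memLp_congr_ae ?_).mpr (MemLp.add hf hg)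
        filter_upwards [Lp.coeFn_add f g] with x hx
        rw [hx]
        exact mul_add _ _ _
      smul_mem' := by
        intro c f hf
        refine (memLp_congr_ae ?_).mpr (MemLp.const_smul hf c)
        filter_upwards [Lp.coeFn_smul c f] with x hx
        rw [hx]
        exact mul_left_comm _ _ _ }
  toFun :=
    { toFun := fun f => MemLp.toLp (fun x => φ x * (f : L2) x) f.2
      map_add' := by
        intro f g
        rw [← MemLp.toLp_add, MemLp.toLp_eq_toLp_iff]
        filter_upwards [Lp.coeFn_add (f : L2) (g : L2)] with x hx
        exact (congrArg (φ x * ·) hx).trans (mul_add _ _ _)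
      map_smul' := by
        intro c f
        rw [RingHom.id_apply, ← MemLp.toLp_const_smul, MemLp.toLp_eq_toLp_iff]
        filter_upwards [Lp.coeFn_smul c (f : L2)] with x hx
        exact (congrArg (φ x * ·) hx).trans (mul_left_comm _ _ _) }

theorem mem_domain_M (φ : L2) {f : L2} (hf : MemLp f ∞ m) : f ∈ (M φ).domain :=
  MemLp.mul (p := 2) (q := ∞) hf (Lp.memLp φ)

/-- The operator `P_α M_φ` restricted to the bounded functions in `K_θ`, evaluated at `f`. -/
def attoApply (φ α : L2) (f : L2) (hf : MemLp f ∞ m) : K α :=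
  P α (M φ ⟨f, mem_domain_M φ hf⟩)

/-- `A = A_φ^{θ,α}`: the bounded operator `A : K_θ → K_α` extends the operator
`P_α M_φ | K_θ ∩ L^∞`. -/
def HasSymbol {θ α : L2} (A : K θ →L[ℂ] K α) (φ : L2) : Prop :=
  ∀ (f : K θ) (hf : MemLp (f : L2) ∞ m), A f = attoApply φ α f hf

/-- The set `𝒯(K_θ, K_α)` of (bounded) asymmetric truncated Toeplitz operators. -/
def ATTO (θ α : L2) : Set (K θ →L[ℂ] K α) :=
  {A | ∃ φ : L2, HasSymbol A φ}

/-- The set `(α / γ) K_γ`. -/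
def quotMulK (α γ : L2) : Set L2 :=
  {φ | ∃ k ∈ K γ, ∀ᵐ x ∂m, φ x = α x / γ x * k x}

end ModelSpace

end

/-!
A bounded `A : K_θ → K_α` intertwining the compressed shifts is determined by the single vector
`ψ = A P_θ 1`: since `S_θ P_θ = P_θ M_z` on `H²`, induction gives `A P_θ z ^ n = P_α (ψ z ^ n)`.
Tested against a bounded `g ∈ K_α`, both sides of `A P_θ h = P_α (ψ h)` are inner products of `h`
with fixed elements of `L²`, so the formula extends in this weak form from monomials to all
`h ∈ H²`. The bounded functions are dense in `K_α`, because `P_α z ^ n` differs from `z ^ n` by `α`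
times a polynomial. Hence `ψ` is a symbol of `A` (`hasSymbol_of_intertwines`).

To locate `ψ`, consider the functional `h ↦ ⟪g, ψ h⟫`, for a bounded `g ∈ K_α`. It vanishes on
`α H²` trivially and on `θ H²` because `P_θ` kills it, hence on the closure of `α H² + θ H²`. By
Beurling's theorem (`exists_eq_mulH2`) this closure is `γ' H²` for an inner `γ'`, which is thereby a
greatest common divisor, and it contains every other one. So `ψ γ ∈ α H²`
(`gcd_mul_mem_mulH2_of_intertwines`), i.e. `ψ = (α / γ) k` with `k ∈ H²`, and `ψ ⊥ α H²` says
`k ⊥ γ H²`.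

Conversely, `φ = (α / γ) k` lies in `H²` and `φ θ = α (θ / γ) k` lies in `α H²`; therefore
`A P_θ z ^ n = P_α (φ z ^ n)`, and `A` intertwines the shifts on a total set
(`HasSymbol.intertwines`).

Beurling's theorem is proved by taking a unit vector `g` of the invariant subspace `N` orthogonal to
`z N`. All nonzero Fourier coefficients of `|g|²` vanish, so the measures `|g|² dm` and `dm` agree,
and `g` is inner; the same orthogonality relations show that nothing in `N` is orthogonal to `g H²`.
-/

namespace ModelSpace


/-! ### Multiplication by bounded functions -/

/-- Multiplication by a bounded function `b`, as a bounded operator on `L²`. The symbol is an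
element of `L²` together with a proof of boundedness, so that products can be iterated without
leaving the type `L2`. -/
noncomputable def bmul (b : L2) (hb : MemLp b ∞ m) : L2 →L[ℂ] L2 :=
  (ContinuousLinearMap.mul ℂ ℂ).holderL m ∞ 2 2 hb.toLp

theorem coeFn_bmul (b : L2) (hb : MemLp b ∞ m) (f : L2) :
    ∀ᵐ x ∂m, bmul b hb f x = b x * f x := by
  have h := (ContinuousLinearMap.mul ℂ ℂ).coeFn_holder (r := 2) hb.toLp f
  filter_upwards [h, hb.coeFn_toLp] with x h1 h2
  rw [← h2]
  exact h1

theorem bmul_comm {b c : L2} (hb : MemLp b ∞ m) (hc : MemLp c ∞ m) :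
    bmul b hb c = bmul c hc b := by
  apply Lp.ext
  filter_upwards [coeFn_bmul b hb c, coeFn_bmul c hc b] with x h1 h2
  rw [h1, h2, mul_comm]

theorem bmul_bmul_comm {b c : L2} (hb : MemLp b ∞ m) (hc : MemLp c ∞ m) (f : L2) :
    bmul b hb (bmul c hc f) = bmul c hc (bmul b hb f) := by
  apply Lp.ext
  filter_upwards [coeFn_bmul b hb (bmul c hc f), coeFn_bmul c hc (bmul b hb f),
    coeFn_bmul b hb f, coeFn_bmul c hc f] with x h1 h2 h3 h4
  rw [h1, h2, h3, h4, mul_left_comm]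

theorem memLp_bmul {b c : L2} (hb : MemLp b ∞ m) (hc : MemLp c ∞ m) :
    MemLp (bmul b hb c) ∞ m :=
  (memLp_congr_ae (coeFn_bmul b hb c)).mpr (MemLp.mul (p := ∞) (q := ∞) hc hb)

theorem memLp_top_sub {f g : L2} (hf : MemLp f ∞ m) (hg : MemLp g ∞ m) :
    MemLp (f - g : L2) ∞ m :=
  (memLp_congr_ae (Lp.coeFn_sub f g)).mpr (hf.sub hg)

theorem coeFn_M (φ : L2) {f : L2} (hf : MemLp f ∞ m) :
    ∀ᵐ x ∂m, M φ ⟨f, mem_domain_M φ hf⟩ x = φ x * f x :=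
  MemLp.coeFn_toLp (mem_domain_M φ hf : MemLp (fun x => φ x * f x) 2 m)

theorem M_eq_bmul (φ : L2) {f : L2} (hf : MemLp f ∞ m) :
    M φ ⟨f, mem_domain_M φ hf⟩ = bmul f hf φ := by
  apply Lp.ext
  filter_upwards [coeFn_M φ hf, coeFn_bmul f hf φ] with x h1 h2
  rw [h1, h2, mul_comm]

theorem inner_eq_integral (f g : L2) : inner ℂ f g = ∫ x, star (f x) * g x ∂m := by
  rw [L2.inner_def]
  refine integral_congr_ae (.of_forall fun x => ?_)
  simp [mul_comm]

/-- For bounded `g`, the pairing `⟪g, b ψ⟫` equals `⟪ψ̄ g, b⟫` with `ψ̄ g ∈ L²`. So it extends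
continuously to all `b ∈ L²`, although `b ψ` need not be in `L²`. -/
theorem exists_inner_eq_inner_bmul (ψ : L2) {g : L2} (hg : MemLp g ∞ m) :
    ∃ w : L2, ∀ (b : L2) (hb : MemLp b ∞ m), inner ℂ w b = inner ℂ g (bmul b hb ψ) := by
  have hw : MemLp (fun x => star (ψ x) * g x) 2 m :=
    MemLp.mul (p := 2) (q := ∞) hg (Lp.memLp ψ).star
  refine ⟨hw.toLp, fun b hb => ?_⟩
  rw [inner_eq_integral, inner_eq_integral]
  refine integral_congr_ae ?_
  filter_upwards [hw.coeFn_toLp, coeFn_bmul b hb ψ] with x h1 h2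
  rw [h1, h2, star_mul, star_star]
  ring

/-! ### Monomials and the Hardy space -/

/-- The monomial `z ^ n` as an element of `L²`. -/
noncomputable abbrev zpow (n : ℤ) : L2 := fourierLp 2 n

theorem coeFn_zpow (n : ℤ) : ∀ᵐ x ∂m, zpow n x = fourier n x := coeFn_fourierLp 2 n

theorem memLp_zpow (n : ℤ) : MemLp (zpow n) ∞ m :=
  (memLp_congr_ae ((coeFn_fourierLp 2 n).trans (coeFn_fourierLp ∞ n).symm)).mpr (Lp.memLp _)

theorem bmul_zpow_zero (f : L2) : bmul (zpow 0) (memLp_zpow 0) f = f := by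
  apply Lp.ext
  filter_upwards [coeFn_bmul _ (memLp_zpow 0) f, coeFn_zpow 0] with x h1 h2
  rw [h1, h2, fourier_zero, one_mul]

theorem mulZ_eq_bmul (f : L2) : mulZ f = bmul (zpow 1) (memLp_zpow 1) f := by
  apply Lp.ext
  filter_upwards [coeFn_mulZ f, coeFn_bmul _ (memLp_zpow 1) f, coeFn_zpow 1] with x h1 h2 h3
  rw [h1, h2, h3]

theorem mulZ_bmul {b : L2} (hb : MemLp b ∞ m) (f : L2) :
    mulZ (bmul b hb f) = bmul b hb (mulZ f) := by
  rw [mulZ_eq_bmul, mulZ_eq_bmul, bmul_bmul_comm]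

theorem mulZ_bmul_zpow (n : ℤ) (f : L2) :
    mulZ (bmul (zpow n) (memLp_zpow n) f) = bmul (zpow (n + 1)) (memLp_zpow (n + 1)) f := by
  apply Lp.ext
  filter_upwards [coeFn_mulZ (bmul (zpow n) (memLp_zpow n) f), coeFn_bmul _ (memLp_zpow n) f,
    coeFn_bmul _ (memLp_zpow (n + 1)) f, coeFn_zpow n, coeFn_zpow (n + 1)] with x h1 h2 h3 h4 h5
  rw [h1, h2, h3, h4, h5, fourier_add]
  ring

theorem mulZ_zpow (n : ℤ) : mulZ (zpow n) = zpow (n + 1) := by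
  apply Lp.ext
  filter_upwards [coeFn_mulZ (zpow n), coeFn_zpow n, coeFn_zpow (n + 1)] with x h1 h2 h3
  rw [h1, h2, h3, fourier_add, mul_comm]

/-- Shift rule for Fourier coefficients of a product with a monomial. -/
theorem inner_zpow_bmul_zpow (k n : ℤ) (b : L2) :
    inner ℂ (zpow k) (bmul (zpow n) (memLp_zpow n) b) = inner ℂ (zpow (k - n)) b := by
  rw [inner_eq_integral, inner_eq_integral]
  refine integral_congr_ae ?_
  filter_upwards [coeFn_bmul _ (memLp_zpow n) b, coeFn_zpow k, coeFn_zpow n,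
    coeFn_zpow (k - n)] with x h1 h2 h3 h4
  rw [h1, h2, h3, h4, ← starRingEnd_apply, ← starRingEnd_apply, ← fourier_neg, ← fourier_neg,
    ← mul_assoc, ← fourier_add]
  congr 3
  ring

theorem inner_zpow_mulZ (k : ℤ) (f : L2) :
    inner ℂ (zpow k) (mulZ f) = inner ℂ (zpow (k - 1)) f := by
  rw [mulZ_eq_bmul, inner_zpow_bmul_zpow]

theorem fourierCoeff_eq_inner (f : L2) (n : ℤ) : fourierCoeff f n = inner ℂ (zpow n) f := by
  rw [← fourierBasis_repr, HilbertBasis.repr_apply_apply, coe_fourierBasis]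

theorem mem_H2_iff {f : L2} : f ∈ H2 ↔ ∀ n : ℤ, n < 0 → inner ℂ (zpow n) f = 0 :=
  forall₂_congr fun n _ => by rw [fourierCoeff_eq_inner]

theorem eq_zero_of_inner_zpow {f : L2} (h : ∀ n : ℤ, inner ℂ (zpow n) f = 0) : f = 0 := by
  apply (fourierBasis (T := 1)).repr.injective
  ext n
  rw [HilbertBasis.repr_apply_apply, coe_fourierBasis, h n]
  simp

theorem zpow_mem_H2 {n : ℤ} (hn : 0 ≤ n) : zpow n ∈ H2 :=
  mem_H2_iff.mpr fun k hk => orthonormal_fourier.inner_eq_zero (by omega)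

theorem hasSum_zpow (f : L2) : HasSum (fun n : ℤ => (inner ℂ (zpow n) f : ℂ) • zpow n) f := by
  have h := (fourierBasis (T := 1)).hasSum_repr f
  simpa only [HilbertBasis.repr_apply_apply, coe_fourierBasis] using h

/-- `H²` is the closed span of the monomials `z ^ n`, `n ≥ 0`. -/
theorem H2_le_of_zpow_mem {N : Submodule ℂ L2} (hN : IsClosed (N : Set L2))
    (h : ∀ n : ℤ, 0 ≤ n → zpow n ∈ N) : H2 ≤ N := fun f hf => by
  refine hN.mem_of_tendsto (hasSum_zpow f) (.of_forall fun s => N.sum_mem fun n _ => ?_)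
  rcases lt_or_ge n 0 with hn | hn
  · rw [mem_H2_iff.mp hf n hn, zero_smul]
    exact N.zero_mem
  · exact N.smul_mem _ (h n hn)

theorem eqOn_H2_of_eq_zpow {E : Type*} [NormedAddCommGroup E] [NormedSpace ℂ E]
    {T U : L2 →L[ℂ] E} (h : ∀ n : ℤ, 0 ≤ n → T (zpow n) = U (zpow n)) {f : L2} (hf : f ∈ H2) :
    T f = U f :=
  H2_le_of_zpow_mem (N := LinearMap.eqLocus (T : L2 →ₗ[ℂ] E) (U : L2 →ₗ[ℂ] E))
    (isClosed_eq T.continuous U.continuous) h hf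

theorem bmul_mem_H2 {b : L2} (hb : MemLp b ∞ m) (hbH : b ∈ H2) {f : L2} (hf : f ∈ H2) :
    bmul b hb f ∈ H2 := by
  refine H2_le_of_zpow_mem (N := H2.comap (bmul b hb : L2 →ₗ[ℂ] L2))
    (isClosed_H2.preimage (bmul b hb).continuous) (fun n hn => ?_) hf
  rw [Submodule.mem_comap, ContinuousLinearMap.coe_coe, bmul_comm hb (memLp_zpow n), mem_H2_iff]
  intro k hk
  rw [inner_zpow_bmul_zpow]
  exact mem_H2_iff.mp hbH _ (by omega)

theorem mulZ_mem_H2 {f : L2} (hf : f ∈ H2) : mulZ f ∈ H2 := by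
  rw [mulZ_eq_bmul]
  exact bmul_mem_H2 _ (zpow_mem_H2 zero_le_one) hf

/-- A function in `H²` with finitely many Fourier coefficients is an analytic polynomial, hence
bounded. -/
theorem memLp_top_of_inner_zpow_eq_zero {h : L2} (hh : h ∈ H2) (N : ℤ)
    (hN : ∀ k : ℤ, N < k → inner ℂ (zpow k) h = 0) : MemLp h ∞ m := by
  have hs : HasSum (fun n : ℤ => (inner ℂ (zpow n) h : ℂ) • zpow n)
      (∑ n ∈ Finset.Icc 0 N, (inner ℂ (zpow n) h : ℂ) • zpow n) := by
    refine hasSum_sum_of_ne_finset_zero fun n hn => ?_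
    rw [Finset.mem_Icc, not_and_or, not_le, not_le] at hn
    rcases hn with hn | hn
    · rw [mem_H2_iff.mp hh n hn, zero_smul]
    · rw [hN n hn, zero_smul]
  have key : ∀ s : Finset ℤ,
      MemLp (∑ n ∈ s, (inner ℂ (zpow n) h : ℂ) • zpow n : L2) ∞ m := by
    intro s
    induction s using Finset.induction_on with
    | empty =>
      rw [Finset.sum_empty]
      exact (memLp_congr_ae (Lp.coeFn_zero ℂ 2 m)).mpr MemLp.zero
    | insert a s ha ih =>
      rw [Finset.sum_insert ha]
      refine (memLp_congr_ae (Lp.coeFn_add _ _)).mpr (MemLp.add ?_ ih)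
      exact (memLp_congr_ae (Lp.coeFn_smul _ _)).mpr ((memLp_zpow a).const_smul _)
  rw [(hasSum_zpow h).unique hs]
  exact key _

/-! ### Inner functions and the subspaces `θ H²` -/

theorem memLp_top_of_norm_eq_one {θ : L2} (hθ : ∀ᵐ x ∂m, ‖θ x‖ = 1) : MemLp θ ∞ m :=
  memLp_top_of_bound (Lp.aestronglyMeasurable θ) 1 (hθ.mono fun _ h => h.le)

theorem IsInner.memLp {θ : L2} (hθ : IsInner θ) : MemLp θ ∞ m := memLp_top_of_norm_eq_one hθ.2

/-- Multiplication by an inner function. -/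
noncomputable abbrev IsInner.mul {θ : L2} (hθ : IsInner θ) : L2 →L[ℂ] L2 := bmul θ hθ.memLp

theorem IsInner.inner_mul_mul {θ : L2} (hθ : IsInner θ) (f g : L2) :
    inner ℂ (hθ.mul f) (hθ.mul g) = inner ℂ f g := by
  rw [inner_eq_integral, inner_eq_integral]
  refine integral_congr_ae ?_
  filter_upwards [coeFn_bmul θ hθ.memLp f, coeFn_bmul θ hθ.memLp g, hθ.2] with x h1 h2 h3
  have h4 : star (θ x) * θ x = 1 := by
    rw [← starRingEnd_apply, mul_comm, Complex.mul_conj']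
    simp [h3]
  rw [h1, h2, star_mul]
  linear_combination star (f x) * g x * h4

theorem IsInner.mul_mem_H2 {θ : L2} (hθ : IsInner θ) {f : L2} (hf : f ∈ H2) : hθ.mul f ∈ H2 :=
  bmul_mem_H2 _ hθ.1 hf

theorem IsInner.mem_mulH2 {θ : L2} (hθ : IsInner θ) {f : L2} :
    f ∈ mulH2 θ ↔ ∃ h ∈ H2, f = hθ.mul h := by
  refine exists_congr fun h => and_congr_right fun _ => ⟨fun hf => ?_, fun hf => ?_⟩
  · apply Lp.ext
    filter_upwards [hf, coeFn_bmul θ hθ.memLp h] with x h1 h2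
    rw [h1, h2]
  · rw [hf]
    exact coeFn_bmul θ hθ.memLp h

theorem IsInner.mul_mem_mulH2 {θ : L2} (hθ : IsInner θ) {h : L2} (hh : h ∈ H2) :
    hθ.mul h ∈ mulH2 θ := hθ.mem_mulH2.mpr ⟨h, hh, rfl⟩

theorem IsInner.mem_mulH2_self {θ : L2} (hθ : IsInner θ) : θ ∈ mulH2 θ := by
  have h := hθ.mul_mem_mulH2 (zpow_mem_H2 le_rfl)
  rwa [IsInner.mul, bmul_comm _ (memLp_zpow 0), bmul_zpow_zero] at h

theorem IsInner.mulH2_le_H2 {θ : L2} (hθ : IsInner θ) : mulH2 θ ≤ H2 := fun f hf => by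
  obtain ⟨h, hh, rfl⟩ := hθ.mem_mulH2.mp hf
  exact hθ.mul_mem_H2 hh

theorem IsInner.mulZ_mem_mulH2 {θ : L2} (hθ : IsInner θ) {f : L2} (hf : f ∈ mulH2 θ) :
    mulZ f ∈ mulH2 θ := by
  obtain ⟨h, hh, rfl⟩ := hθ.mem_mulH2.mp hf
  rw [IsInner.mul, mulZ_bmul]
  exact hθ.mul_mem_mulH2 (mulZ_mem_H2 hh)

theorem isClosed_map_of_norm_eq {T : L2 →L[ℂ] L2} (hT : ∀ f, ‖T f‖ = ‖f‖)
    {N : Submodule ℂ L2} (hN : IsClosed (N : Set L2)) :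
    IsClosed (N.map (T : L2 →ₗ[ℂ] L2) : Set L2) := by
  rw [Submodule.map_coe]
  exact (AddMonoidHomClass.isometry_of_norm T hT).isClosedEmbedding.isClosedMap _ hN

theorem IsInner.norm_mul {θ : L2} (hθ : IsInner θ) (f : L2) : ‖hθ.mul f‖ = ‖f‖ := by
  rw [norm_eq_sqrt_re_inner (𝕜 := ℂ), hθ.inner_mul_mul, ← norm_eq_sqrt_re_inner]

theorem IsInner.isClosed_mulH2 {θ : L2} (hθ : IsInner θ) : IsClosed (mulH2 θ : Set L2) := by
  convert isClosed_map_of_norm_eq hθ.norm_mul isClosed_H2 using 1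
  ext f
  rw [SetLike.mem_coe, hθ.mem_mulH2, SetLike.mem_coe, Submodule.mem_map]
  simp only [ContinuousLinearMap.coe_coe, eq_comm]

theorem InnerDvd.mulH2_le {δ θ : L2} (hδ : IsInner δ) (hθ : IsInner θ) (h : InnerDvd δ θ) :
    mulH2 θ ≤ mulH2 δ := by
  obtain ⟨b, hb, hdb⟩ := h
  intro f hf
  obtain ⟨h, hh, rfl⟩ := hθ.mem_mulH2.mp hf
  refine hδ.mem_mulH2.mpr ⟨hb.mul h, hb.mul_mem_H2 hh, ?_⟩
  apply Lp.ext
  filter_upwards [hdb, coeFn_bmul θ hθ.memLp h, coeFn_bmul b hb.memLp h,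
    coeFn_bmul δ hδ.memLp (hb.mul h)] with x h1 h2 h3 h4
  rw [h2, h4, h3, h1, mul_assoc]

theorem InnerDvd.of_mem_mulH2 {δ θ : L2} (hδ : IsInner δ) (hθ : IsInner θ) (h : θ ∈ mulH2 δ) :
    InnerDvd δ θ := by
  obtain ⟨b, hb, hdb⟩ := h
  refine ⟨b, ⟨hb, ?_⟩, hdb⟩
  filter_upwards [hdb, hδ.2, hθ.2] with x h1 h2 h3
  rwa [h1, norm_mul, h2, one_mul] at h3


/-! ### Invariant subspaces of `H²` -/

/-- Integration of continuous functions against a finite measure on the circle. -/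
noncomputable def integralC (ν : Measure UnitAddCircle) [IsFiniteMeasure ν] :
    C(UnitAddCircle, ℂ) →L[ℂ] ℂ :=
  LinearMap.mkContinuous
    { toFun := fun f => ∫ x, f x ∂ν
      map_add' := fun f g => integral_add
        (f.continuous.integrable_of_hasCompactSupport (.of_compactSpace f))
        (g.continuous.integrable_of_hasCompactSupport (.of_compactSpace g))
      map_smul' := fun c f => integral_const_mul c f }
    (ν.real Set.univ) fun f => by
      rw [mul_comm]
      exact norm_integral_le_of_norm_le_const (.of_forall f.norm_coe_le_norm)

theorem integralC_apply (ν : Measure UnitAddCircle) [IsFiniteMeasure ν]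
    (f : C(UnitAddCircle, ℂ)) : integralC ν f = ∫ x, f x ∂ν := rfl

/-- A finite measure on the circle is determined by its Fourier coefficients. -/
theorem measure_ext_of_integral_fourier {μ ν : Measure UnitAddCircle} [IsFiniteMeasure μ]
    [IsFiniteMeasure ν]
    (h : ∀ n : ℤ, ∫ x, (fourier n x : ℂ) ∂μ = ∫ x, (fourier n x : ℂ) ∂ν) : μ = ν := by
  have hI : integralC μ = integralC ν := by
    refine ContinuousLinearMap.ext_on (s := Set.range (fourier (T := 1))) ?_ ?_
    · rw [Submodule.dense_iff_topologicalClosure_eq_top]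
      exact span_fourier_closure_eq_top
    · rintro _ ⟨n, rfl⟩
      rw [integralC_apply, integralC_apply, h]
  refine ext_of_forall_integral_eq_of_IsFiniteMeasure fun f => ?_
  have h1 := DFunLike.congr_fun hI ⟨fun x => (f x : ℂ), by fun_prop⟩
  rw [integralC_apply, integralC_apply] at h1
  simp only [ContinuousMap.coe_mk] at h1
  rw [integral_complex_ofReal, integral_complex_ofReal] at h1
  exact_mod_cast h1

/-- A unit vector orthogonal to all of its shifts is unimodular, because all nonzero Fourier
coefficients of `|g|²` vanish. -/
theorem norm_eq_one_of_inner_bmul_zpow {g : L2} (hg : ‖g‖ = 1)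
    (h : ∀ n : ℤ, 0 < n → inner ℂ g (bmul (zpow n) (memLp_zpow n) g) = 0) :
    ∀ᵐ x ∂m, ‖g x‖ = 1 := by
  have hmeas : Measurable fun x => ‖g x‖₊ ^ 2 :=
    (Lp.stronglyMeasurable g).measurable.nnnorm.pow_const 2
  have hL : ∫⁻ x, ((‖g x‖₊ ^ 2 : NNReal) : ℝ≥0∞) ∂m ≠ ∞ := by
    have h1 := (Lp.memLp g).eLpNorm_lt_top
    rw [eLpNorm_lt_top_iff_lintegral_rpow_enorm_lt_top (by norm_num) (by norm_num)] at h1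
    refine ne_of_lt (lt_of_le_of_lt (lintegral_mono fun x => le_of_eq ?_) h1)
    simp [enorm_eq_nnnorm]
  have hfin : IsFiniteMeasure (m.withDensity fun x => ((‖g x‖₊ ^ 2 : NNReal) : ℝ≥0∞)) :=
    isFiniteMeasure_withDensity hL
  have hint : ∀ n : ℤ, ∫ x, (fourier n x : ℂ)
      ∂(m.withDensity fun x => ((‖g x‖₊ ^ 2 : NNReal) : ℝ≥0∞)) =
        inner ℂ g (bmul (zpow n) (memLp_zpow n) g) := by
    intro n
    rw [integral_withDensity_eq_integral_smul hmeas, inner_eq_integral]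
    refine integral_congr_ae ?_
    filter_upwards [coeFn_bmul (zpow n) (memLp_zpow n) g, coeFn_zpow n] with x h1 h2
    have h3 : star (g x) * g x = (‖g x‖ : ℂ) ^ 2 := by
      rw [← starRingEnd_apply, mul_comm, Complex.mul_conj']
    have h4 : (‖g x‖₊ ^ 2) • (fourier n x : ℂ) = (‖g x‖ : ℂ) ^ 2 * fourier n x := by
      rw [NNReal.smul_def, Complex.real_smul]
      push_cast
      rfl
    rw [h1, h2, h4]
    linear_combination -(fourier n x : ℂ) * h3
  have hm : ∀ n : ℤ, ∫ x, (fourier n x : ℂ) ∂m = if n = 0 then 1 else 0 := by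
    intro n
    have h1 := orthonormal_iff_ite.mp (orthonormal_fourier (T := 1)) 0 n
    rw [inner_eq_integral] at h1
    simp only [eq_comm (a := n)]
    rw [← h1]
    refine integral_congr_ae ?_
    filter_upwards [coeFn_zpow 0, coeFn_zpow n] with x h2 h3
    rw [h2, h3, fourier_zero, star_one, one_mul]
  have hμ : m.withDensity (fun x => ((‖g x‖₊ ^ 2 : NNReal) : ℝ≥0∞)) = m := by
    refine measure_ext_of_integral_fourier fun n => ?_
    rw [hint, hm]
    rcases lt_trichotomy n 0 with hn | rfl | hn
    · have h1 : inner ℂ g (bmul (zpow n) (memLp_zpow n) g) =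
          star (inner ℂ g (bmul (zpow (-n)) (memLp_zpow (-n)) g) : ℂ) := by
        rw [← starRingEnd_apply, inner_conj_symm, inner_eq_integral, inner_eq_integral]
        refine integral_congr_ae ?_
        filter_upwards [coeFn_bmul (zpow n) (memLp_zpow n) g, coeFn_zpow n,
          coeFn_bmul (zpow (-n)) (memLp_zpow (-n)) g, coeFn_zpow (-n)] with x h2 h3 h4 h5
        rw [h2, h3, h4, h5, fourier_neg, star_mul, ← starRingEnd_apply, ← starRingEnd_apply,
          RingHomCompTriple.comp_apply, RingHom.id_apply]
        ring
      rw [h1, h _ (by omega), star_zero, if_neg hn.ne]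
    · rw [bmul_zpow_zero, inner_self_eq_norm_sq_to_K, hg]
      simp
    · rw [h n hn, if_neg hn.ne']
  have h1 : m.withDensity (fun x => ((‖g x‖₊ ^ 2 : NNReal) : ℝ≥0∞)) =
      m.withDensity (fun _ => 1) := by
    rw [hμ, withDensity_const, one_smul]
  rw [withDensity_eq_iff hmeas.coe_nnreal_ennreal.aemeasurable aemeasurable_const hL] at h1
  filter_upwards [h1] with x hx
  have h2 : ‖g x‖₊ ^ 2 = 1 := by exact_mod_cast hx
  rw [pow_eq_one_iff_of_nonneg zero_le two_ne_zero] at h2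
  rw [← coe_nnnorm, h2, NNReal.coe_one]

theorem norm_mulZ (f : L2) : ‖mulZ f‖ = ‖f‖ := by
  have hz : IsInner (zpow 1) := ⟨zpow_mem_H2 zero_le_one, by
    filter_upwards [coeFn_zpow 1] with x hx
    rw [hx, fourier_one, Circle.norm_coe]⟩
  rw [mulZ_eq_bmul]
  exact hz.norm_mul f

/-- A nonzero closed invariant subspace contains a unit vector orthogonal to its shift: otherwise
it equals its own shift, so its elements vanish to infinite order at the origin. -/
theorem exists_unit_orthogonal_map_mulZ {N : Submodule ℂ L2} (hc : IsClosed (N : Set L2))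
    (hN : N ≤ H2) (h0 : N ≠ ⊥) (hz : ∀ f ∈ N, mulZ f ∈ N) :
    ∃ g ∈ N, ‖g‖ = 1 ∧ ∀ f ∈ N, inner ℂ g (mulZ f) = 0 := by
  by_contra! hcon
  have hz' : N.map (mulZ : L2 →ₗ[ℂ] L2) ≤ N := by
    rintro _ ⟨f, hf, rfl⟩
    exact hz f hf
  have hcomp : CompleteSpace (N.map (mulZ : L2 →ₗ[ℂ] L2)) :=
    (isClosed_map_of_norm_eq norm_mulZ hc).completeSpace_coe
  have hwander : (N.map (mulZ : L2 →ₗ[ℂ] L2))ᗮ ⊓ N = ⊥ := by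
    rw [Submodule.eq_bot_iff]
    rintro g ⟨hg1, hg2⟩
    by_contra hg0
    obtain ⟨f, hf, hne⟩ := hcon ((‖g‖⁻¹ : ℂ) • g) (N.smul_mem _ hg2) (by
      simp [norm_smul, hg0])
    refine hne ?_
    rw [inner_smul_left]
    exact mul_eq_zero_of_right _ (Submodule.inner_left_of_mem_orthogonal (𝕜 := ℂ)
      (Submodule.mem_map_of_mem (f := (mulZ : L2 →ₗ[ℂ] L2)) hf) hg1)
  have hsurj : N.map (mulZ : L2 →ₗ[ℂ] L2) = N := by
    have h := Submodule.sup_orthogonal_inf_of_hasOrthogonalProjection hz'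
    rwa [hwander, sup_bot_eq] at h
  have hvan : ∀ (n : ℕ) (f : L2), f ∈ N → ∀ k : ℤ, k < n → inner ℂ (zpow k) f = 0 := by
    intro n
    induction n with
    | zero => exact fun f hf k hk => mem_H2_iff.mp (hN hf) k (by exact_mod_cast hk)
    | succ n ih =>
      intro f hf k hk
      rw [← hsurj] at hf
      obtain ⟨f', hf', rfl⟩ := hf
      rw [ContinuousLinearMap.coe_coe, inner_zpow_mulZ]
      exact ih f' hf' _ (by push_cast at hk; omega)
  exact h0 ((Submodule.eq_bot_iff N).mpr fun f hf => eq_zero_of_inner_zpow fun k =>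
    hvan (k.toNat + 1) f hf k (by push_cast; omega))

/-- **Beurling's theorem**: a nonzero closed subspace of `H²` that is invariant under
multiplication by `z` is of the form `γ H²` with `γ` inner. -/
theorem exists_eq_mulH2 {N : Submodule ℂ L2} (hc : IsClosed (N : Set L2)) (hN : N ≤ H2)
    (h0 : N ≠ ⊥) (hz : ∀ f ∈ N, mulZ f ∈ N) : ∃ γ : L2, IsInner γ ∧ N = mulH2 γ := by
  obtain ⟨g, hgN, hg1, hg⟩ := exists_unit_orthogonal_map_mulZ hc hN h0 hz
  have hzn : ∀ f ∈ N, ∀ n : ℕ, bmul (zpow n) (memLp_zpow n) f ∈ N := by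
    intro f hf n
    induction n with
    | zero => exact (bmul_zpow_zero f).symm ▸ hf
    | succ n ih => exact mulZ_bmul_zpow n f ▸ hz _ ih
  have hort : ∀ f ∈ N, ∀ n : ℤ, 0 < n → inner ℂ g (bmul (zpow n) (memLp_zpow n) f) = 0 := by
    intro f hf n hn
    obtain ⟨k, rfl⟩ : ∃ k : ℕ, n = k + 1 := ⟨(n - 1).toNat, by omega⟩
    rw [← mulZ_bmul_zpow]
    exact hg _ (hzn f hf k)
  have hγ : IsInner g := ⟨hN hgN, norm_eq_one_of_inner_bmul_zpow hg1 (hort g hgN)⟩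
  have hle : mulH2 g ≤ N := by
    intro f hf
    obtain ⟨h, hh, rfl⟩ := hγ.mem_mulH2.mp hf
    refine H2_le_of_zpow_mem (N := N.comap (hγ.mul : L2 →ₗ[ℂ] L2))
      (hc.preimage hγ.mul.continuous) (fun n hn => ?_) hh
    rw [Submodule.mem_comap, ContinuousLinearMap.coe_coe, IsInner.mul,
      bmul_comm _ (memLp_zpow n)]
    lift n to ℕ using hn
    exact hzn g hgN n
  have hcomp : CompleteSpace (mulH2 g) := hγ.isClosed_mulH2.completeSpace_coe
  refine ⟨g, hγ, (Submodule.sup_orthogonal_inf_of_hasOrthogonalProjection hle).symm.trans ?_⟩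
  rw [sup_eq_left]
  rintro f ⟨hf, hfN⟩
  -- All Fourier coefficients of `f ḡ` vanish: those of index `≥ 0` because `f ⊥ g H²`, the others
  -- because `g` is orthogonal to `z N`.
  have hw : MemLp (fun x => star (g x) * f x) 2 m :=
    MemLp.mul (p := ∞) (q := 2) (Lp.memLp f) hγ.memLp.star
  have hcoef : ∀ n : ℤ, inner ℂ (zpow n) hw.toLp =
      inner ℂ (bmul (zpow n) (memLp_zpow n) g) f := by
    intro n
    rw [inner_eq_integral, inner_eq_integral]
    refine integral_congr_ae ?_
    filter_upwards [hw.coeFn_toLp, coeFn_bmul (zpow n) (memLp_zpow n) g] with x h1 h2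
    rw [h1, h2, star_mul]
    ring
  have hw0 : hw.toLp = 0 := by
    refine eq_zero_of_inner_zpow fun n => ?_
    rw [hcoef]
    rcases lt_or_ge n 0 with hn | hn
    · rw [← hort f hfN (-n) (by omega), inner_eq_integral, inner_eq_integral]
      refine integral_congr_ae ?_
      filter_upwards [coeFn_bmul (zpow n) (memLp_zpow n) g, coeFn_zpow n,
        coeFn_bmul (zpow (-n)) (memLp_zpow (-n)) f, coeFn_zpow (-n)] with x h2 h3 h4 h5
      rw [h2, h3, h4, h5, fourier_neg, star_mul, ← starRingEnd_apply, ← starRingEnd_apply]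
      ring
    · rw [bmul_comm _ hγ.memLp]
      exact Submodule.inner_right_of_mem_orthogonal (hγ.mul_mem_mulH2 (zpow_mem_H2 hn)) hf
  have hf0 : f = 0 := by
    apply Lp.ext
    filter_upwards [hw.coeFn_toLp, Lp.coeFn_zero ℂ 2 m, hγ.2] with x h1 h2 h3
    rw [hw0, h2] at h1
    have h4 : star (g x) ≠ 0 := star_ne_zero.mpr fun h => by simp [h] at h3
    rw [h2]
    exact (mul_eq_zero.mp h1.symm).resolve_left h4
  rw [hf0]
  exact (mulH2 g).zero_mem

/-! ### Greatest common divisors -/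

/-- The inner functions `α` and `θ` have a common divisor which generates the closure of
`α H² + θ H²`. -/
theorem exists_closure_eq_mulH2 {α θ : L2} (hα : IsInner α) (hθ : IsInner θ) :
    ∃ γ : L2, IsInner γ ∧ (mulH2 α ⊔ mulH2 θ).topologicalClosure = mulH2 γ := by
  refine exists_eq_mulH2 (Submodule.isClosed_topologicalClosure _)
    (Submodule.topologicalClosure_minimal _ (sup_le hα.mulH2_le_H2 hθ.mulH2_le_H2) isClosed_H2)
    ?_ ?_
  · intro h
    have h1 : α ∈ (mulH2 α ⊔ mulH2 θ).topologicalClosure :=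
      Submodule.le_topologicalClosure _ (Submodule.mem_sup_left hα.mem_mulH2_self)
    rw [h, Submodule.mem_bot] at h1
    have h2 : ∀ᵐ x ∂m, False := by
      filter_upwards [hα.2, Lp.coeFn_zero ℂ 2 m] with x h3 h4
      rw [h1, h4] at h3
      simp at h3
    exact NeZero.ne m (by simpa using h2)
  · intro f hf
    have hle : mulH2 α ⊔ mulH2 θ ≤
        (mulH2 α ⊔ mulH2 θ).topologicalClosure.comap (mulZ : L2 →ₗ[ℂ] L2) := by
      refine sup_le (fun f hf => ?_) (fun f hf => ?_)
      · exact Submodule.le_topologicalClosure _ (Submodule.mem_sup_left (hα.mulZ_mem_mulH2 hf))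
      · exact Submodule.le_topologicalClosure _ (Submodule.mem_sup_right (hθ.mulZ_mem_mulH2 hf))
    exact Submodule.topologicalClosure_minimal _ hle
      ((Submodule.isClosed_topologicalClosure _).preimage mulZ.continuous) hf

theorem innerDvd_of_closure_eq_mulH2 {α θ γ : L2} (hα : IsInner α) (hθ : IsInner θ)
    (hγ : IsInner γ) (h : (mulH2 α ⊔ mulH2 θ).topologicalClosure = mulH2 γ) :
    InnerDvd γ α ∧ InnerDvd γ θ :=
  ⟨.of_mem_mulH2 hγ hα (h ▸ Submodule.le_topologicalClosure _
      (Submodule.mem_sup_left hα.mem_mulH2_self)),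
    .of_mem_mulH2 hγ hθ (h ▸ Submodule.le_topologicalClosure _
      (Submodule.mem_sup_right hθ.mem_mulH2_self))⟩

theorem exists_isInnerGCD {α θ : L2} (hα : IsInner α) (hθ : IsInner θ) :
    ∃ γ : L2, IsInnerGCD γ α θ := by
  obtain ⟨γ, hγ, h⟩ := exists_closure_eq_mulH2 hα hθ
  obtain ⟨h1, h2⟩ := innerDvd_of_closure_eq_mulH2 hα hθ hγ h
  refine ⟨γ, hγ, h1, h2, fun δ hδ hδα hδθ => .of_mem_mulH2 hδ hγ ?_⟩
  have hle : (mulH2 α ⊔ mulH2 θ).topologicalClosure ≤ mulH2 δ :=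
    Submodule.topologicalClosure_minimal _ (sup_le (hδα.mulH2_le hδ hα) (hδθ.mulH2_le hδ hθ))
      hδ.isClosed_mulH2
  exact hle (h ▸ hγ.mem_mulH2_self)

/-- Every greatest common divisor of `α` and `θ` is a limit of combinations `α p + θ q` with `p`,
`q` in `H²`. -/
theorem IsInnerGCD.mem_closure {α θ γ : L2} (hα : IsInner α) (hθ : IsInner θ)
    (h : IsInnerGCD γ α θ) : γ ∈ (mulH2 α ⊔ mulH2 θ).topologicalClosure := by
  obtain ⟨γ', hγ', h'⟩ := exists_closure_eq_mulH2 hα hθ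
  obtain ⟨h1, h2⟩ := innerDvd_of_closure_eq_mulH2 hα hθ hγ' h'
  rw [h']
  exact (h.2.2.2 γ' hγ' h1 h2).mulH2_le hγ' h.1 h.1.mem_mulH2_self


/-! ### Model spaces -/

theorem K_le_H2 (θ : L2) : K θ ≤ H2 := inf_le_left

theorem P_coe (θ : L2) (f : K θ) : P θ f = f :=
  Submodule.orthogonalProjectionOnto_mem_subspace_eq_self f

theorem inner_P_left (θ f g : L2) : inner ℂ (P θ f : L2) g = inner ℂ f (P θ g : L2) :=
  (K θ).inner_starProjection_left_eq_right f g

theorem P_eq_zero_of_mem_mulH2 {θ x : L2} (hx : x ∈ mulH2 θ) : P θ x = 0 :=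
  Submodule.orthogonalProjectionOnto_eq_zero_iff.mpr
    (Submodule.orthogonal_le inf_le_right (Submodule.le_orthogonal_orthogonal _ hx))

/-- The decomposition `H² = K_θ ⊕ θ H²`. -/
theorem IsInner.exists_eq_P_add {θ : L2} (hθ : IsInner θ) {x : L2} (hx : x ∈ H2) :
    ∃ h ∈ H2, x = P θ x + hθ.mul h := by
  have hcomp : CompleteSpace (mulH2 θ) := hθ.isClosed_mulH2.completeSpace_coe
  obtain ⟨y, hy, w, hw, hxy⟩ := (mulH2 θ).exists_add_mem_mem_orthogonal x
  have hwK : w ∈ K θ := by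
    refine ⟨?_, hw⟩
    rw [← add_sub_cancel_left y w, ← hxy]
    exact H2.sub_mem hx (hθ.mulH2_le_H2 hy)
  have hP : (P θ x : L2) = w := by
    rw [hxy, map_add, P_eq_zero_of_mem_mulH2 hy, zero_add]
    exact congrArg Subtype.val (P_coe θ ⟨w, hwK⟩)
  obtain ⟨h, hh, hyh⟩ := hθ.mem_mulH2.mp hy
  exact ⟨h, hh, by rw [hP, ← hyh, add_comm]; exact hxy⟩

theorem IsInner.mem_mulH2_of_P_eq_zero {θ : L2} (hθ : IsInner θ) {x : L2} (hx : x ∈ H2)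
    (h : P θ x = 0) : x ∈ mulH2 θ := by
  obtain ⟨k, hk, hxk⟩ := hθ.exists_eq_P_add hx
  rw [hxk, h, ZeroMemClass.coe_zero, zero_add]
  exact hθ.mul_mem_mulH2 hk

/-- The operator `P_θ M_z` on `H²` factors through `P_θ`, because `θ H²` is invariant. -/
theorem IsInner.S_P {θ : L2} (hθ : IsInner θ) {x : L2} (hx : x ∈ H2) :
    S θ (P θ x) = P θ (mulZ x) := by
  obtain ⟨h, hh, hxh⟩ := hθ.exists_eq_P_add hx
  change P θ (mulZ (P θ x : L2)) = _
  conv_rhs => rw [hxh, map_add, map_add,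
    P_eq_zero_of_mem_mulH2 (hθ.mulZ_mem_mulH2 (hθ.mul_mem_mulH2 hh)), add_zero]

/-- The projection of a monomial differs from it by `θ h` with `h` an analytic polynomial. Since
the vectors `P_θ (z ^ n)` span `K_θ`, the bounded functions are dense in `K_θ`. -/
theorem IsInner.exists_zpow_eq_P_add {θ : L2} (hθ : IsInner θ) {n : ℤ} (hn : 0 ≤ n) :
    ∃ h ∈ H2, MemLp h ∞ m ∧ zpow n = P θ (zpow n) + hθ.mul h := by
  obtain ⟨h, hh, hnh⟩ := hθ.exists_eq_P_add (zpow_mem_H2 hn)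
  refine ⟨h, hh, memLp_top_of_inner_zpow_eq_zero hh n fun k hk => ?_, hnh⟩
  have h1 : inner ℂ (hθ.mul (zpow k)) (P θ (zpow n) : L2) = 0 :=
    Submodule.inner_right_of_mem_orthogonal (hθ.mul_mem_mulH2 (zpow_mem_H2 (by omega)))
      (P θ (zpow n)).2.2
  have h2 : inner ℂ (hθ.mul (zpow k)) (zpow n) = 0 := by
    rw [← inner_conj_symm, IsInner.mul, bmul_comm _ (memLp_zpow k), inner_zpow_bmul_zpow,
      mem_H2_iff.mp hθ.1 _ (by omega), map_zero]
  rw [hnh, inner_add_right, h1, zero_add, hθ.inner_mul_mul] at h2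
  exact h2

theorem IsInner.memLp_P_zpow {θ : L2} (hθ : IsInner θ) {n : ℤ} (hn : 0 ≤ n) :
    MemLp (P θ (zpow n) : L2) ∞ m := by
  obtain ⟨h, -, hb, hnh⟩ := hθ.exists_zpow_eq_P_add hn
  rw [eq_sub_of_add_eq hnh.symm]
  exact memLp_top_sub (memLp_zpow n) (memLp_bmul _ hb)

theorem K_ext {θ : L2} {E : Type*} [NormedAddCommGroup E] [NormedSpace ℂ E] {T U : K θ →L[ℂ] E}
    (h : ∀ n : ℤ, 0 ≤ n → T (P θ (zpow n)) = U (P θ (zpow n))) : T = U := by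
  ext f
  have h1 := eqOn_H2_of_eq_zpow (T := T ∘L P θ) (U := U ∘L P θ) h (K_le_H2 θ f.2)
  simpa only [ContinuousLinearMap.comp_apply, P_coe] using h1

theorem K_eq_of_inner_P_zpow {θ : L2} {a b : K θ}
    (h : ∀ n : ℤ, 0 ≤ n → inner ℂ (P θ (zpow n) : L2) (a : L2) = inner ℂ (P θ (zpow n) : L2) b) :
    a = b := by
  refine Subtype.ext (sub_eq_zero.mp (eq_zero_of_inner_zpow fun n => ?_))
  rcases lt_or_ge n 0 with hn | hn
  · exact mem_H2_iff.mp (K_le_H2 θ (a - b).2) n hn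
  · have h1 := h n hn
    rwa [inner_P_left, inner_P_left, P_coe, P_coe, ← sub_eq_zero, ← inner_sub_right] at h1

/-! ### Operators intertwining the compressed shifts -/

variable {θ α : L2} {A : K θ →L[ℂ] K α}

/-- If `φ ∈ H²` and `φ θ ∈ α H²`, then a bounded operator with symbol `φ` sends `P_θ (z ^ n)` to
`P_α (φ z ^ n)`, and so intertwines the compressed shifts. -/
theorem HasSymbol.intertwines (hθ : IsInner θ) (hα : IsInner α) {φ : L2} (hA : HasSymbol A φ)
    (hφ : φ ∈ H2) (hφθ : hθ.mul φ ∈ mulH2 α) : S α ∘L A = A ∘L S θ := by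
  have key : ∀ n : ℤ, 0 ≤ n → A (P θ (zpow n)) = P α (bmul (zpow n) (memLp_zpow n) φ) := by
    intro n hn
    obtain ⟨h, hh, hb, hnh⟩ := hθ.exists_zpow_eq_P_add hn
    obtain ⟨k, hk, hφk⟩ := hα.mem_mulH2.mp hφθ
    have hmem : bmul h hb (hθ.mul φ) ∈ mulH2 α := by
      rw [hφk, IsInner.mul, bmul_bmul_comm]
      exact hα.mul_mem_mulH2 (bmul_mem_H2 hb hh hk)
    have hprod : bmul (zpow n) (memLp_zpow n) φ =
        bmul (P θ (zpow n)) (hθ.memLp_P_zpow hn) φ + bmul h hb (hθ.mul φ) := by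
      apply Lp.ext
      filter_upwards [coeFn_bmul (zpow n) (memLp_zpow n) φ,
        coeFn_bmul (P θ (zpow n)) (hθ.memLp_P_zpow hn) φ, coeFn_bmul h hb (hθ.mul φ),
        coeFn_bmul θ hθ.memLp φ, coeFn_bmul θ hθ.memLp h,
        Lp.coeFn_add (bmul (P θ (zpow n)) (hθ.memLp_P_zpow hn) φ) (bmul h hb (hθ.mul φ)),
        Lp.coeFn_add (P θ (zpow n) : L2) (hθ.mul h)] with x h1 h2 h3 h4 h5 h6 h7
      rw [← hnh, Pi.add_apply, h5] at h7
      rw [h6, Pi.add_apply, h1, h2, h3, h4, h7]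
      ring
    rw [hA _ (hθ.memLp_P_zpow hn), attoApply, M_eq_bmul, hprod, map_add,
      P_eq_zero_of_mem_mulH2 hmem, add_zero]
  refine K_ext fun n hn => ?_
  rw [ContinuousLinearMap.comp_apply, ContinuousLinearMap.comp_apply, hθ.S_P (zpow_mem_H2 hn),
    mulZ_zpow, key n hn, key (n + 1) (by omega),
    hα.S_P (bmul_mem_H2 _ (zpow_mem_H2 hn) hφ), mulZ_bmul_zpow]

theorem apply_P_zpow_of_intertwines (hθ : IsInner θ) (hα : IsInner α)
    (hA : S α ∘L A = A ∘L S θ) (n : ℕ) :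
    A (P θ (zpow n)) = P α (bmul (zpow n) (memLp_zpow n) (A (P θ (zpow 0)))) := by
  induction n with
  | zero =>
    rw [Nat.cast_zero, bmul_zpow_zero, P_coe]
  | succ n ih =>
    have h := DFunLike.congr_fun hA (P θ (zpow n))
    have hn : (0 : ℤ) ≤ n := n.cast_nonneg
    rw [ContinuousLinearMap.comp_apply, ContinuousLinearMap.comp_apply,
      hθ.S_P (zpow_mem_H2 hn), mulZ_zpow, ih,
      hα.S_P (bmul_mem_H2 _ (zpow_mem_H2 hn) (K_le_H2 α (A _).2)), mulZ_bmul_zpow] at h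
    exact h.symm

/-- For an intertwining operator `A` put `ψ = A P_θ 1`. In the weak sense (tested against a bounded
`g ∈ K_α`) the formula `A P_θ h = P_α (ψ h)` holds for all `h ∈ H²`: both sides are continuous in
`h` and they agree on monomials. -/
theorem inner_eq_inner_apply_P (hθ : IsInner θ) (hα : IsInner α)
    (hA : S α ∘L A = A ∘L S θ) {g : K α} {w : L2}
    (hw : ∀ (b : L2) (hb : MemLp b ∞ m),
      inner ℂ w b = inner ℂ (g : L2) (bmul b hb (A (P θ (zpow 0))))) {h : L2} (hh : h ∈ H2) :
    inner ℂ w h = inner ℂ (g : L2) (A (P θ h) : L2) := by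
  refine eqOn_H2_of_eq_zpow (T := innerSL ℂ w)
    (U := innerSL ℂ (g : L2) ∘L (K α).subtypeL ∘L A ∘L P θ) (fun n hn => ?_) hh
  lift n to ℕ using hn
  have h1 : inner ℂ w (zpow n) = inner ℂ (g : L2) (A (P θ (zpow n)) : L2) := by
    rw [hw _ (memLp_zpow n), apply_P_zpow_of_intertwines hθ hα hA, ← inner_P_left, P_coe]
  exact h1

/-- An intertwining operator `A` has the symbol `A P_θ 1`. -/
theorem hasSymbol_of_intertwines (hθ : IsInner θ) (hα : IsInner α)
    (hA : S α ∘L A = A ∘L S θ) : HasSymbol A (A (P θ (zpow 0))) := by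
  intro f hf
  refine K_eq_of_inner_P_zpow fun n hn => ?_
  obtain ⟨w, hw⟩ := exists_inner_eq_inner_bmul (A (P θ (zpow 0)) : L2) (hα.memLp_P_zpow hn)
  have h := inner_eq_inner_apply_P hθ hα hA hw (K_le_H2 θ f.2)
  rw [P_coe, hw _ hf] at h
  rw [← h, attoApply, M_eq_bmul, inner_P_left, inner_P_left, P_coe]

/-- With `ψ = A P_θ 1`, one has `ψ γ ∈ α H²`: for each bounded `g ∈ K_α` of a total set, the
continuous extension of `u ↦ ⟪g, ψ u⟫` vanishes on `α H²` and on `θ H²`, hence on the closure of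
their sum, to which `γ` belongs. -/
theorem gcd_mul_mem_mulH2_of_intertwines (hθ : IsInner θ) (hα : IsInner α)
    (hA : S α ∘L A = A ∘L S θ) {γ : L2} (hγ : IsInnerGCD γ α θ) :
    hγ.1.mul (A (P θ (zpow 0))) ∈ mulH2 α := by
  have hψ : (A (P θ (zpow 0)) : L2) ∈ H2 := K_le_H2 α (A _).2
  refine hα.mem_mulH2_of_P_eq_zero (hγ.1.mul_mem_H2 hψ) (K_eq_of_inner_P_zpow fun n hn => ?_)
  rw [ZeroMemClass.coe_zero, inner_zero_right, inner_P_left, P_coe, ← inner_P_left]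
  obtain ⟨w, hw⟩ := exists_inner_eq_inner_bmul (A (P θ (zpow 0)) : L2) (hα.memLp_P_zpow hn)
  rw [← hw γ hγ.1.memLp]
  have hw' {h : L2} (hh : h ∈ H2) := inner_eq_inner_apply_P hθ hα hA hw hh
  have hle : mulH2 α ⊔ mulH2 θ ≤ (innerSL ℂ w : L2 →L[ℂ] ℂ).ker := by
    refine sup_le (fun u hu => ?_) (fun u hu => ?_)
    · obtain ⟨h, hh, rfl⟩ := hα.mem_mulH2.mp hu
      refine H2_le_of_zpow_mem
        (N := ((innerSL ℂ w : L2 →L[ℂ] ℂ).ker).comap (hα.mul : L2 →ₗ[ℂ] L2))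
        ((innerSL ℂ w : L2 →L[ℂ] ℂ).isClosed_ker.preimage hα.mul.continuous)
        (fun k hk => ?_) hh
      have hmem : bmul (hα.mul (zpow k)) (memLp_bmul hα.memLp (memLp_zpow k))
          (A (P θ (zpow 0))) ∈ mulH2 α := by
        refine hα.mem_mulH2.mpr ⟨_, bmul_mem_H2 (memLp_zpow k) (zpow_mem_H2 hk) hψ, ?_⟩
        apply Lp.ext
        filter_upwards [coeFn_bmul (hα.mul (zpow k)) (memLp_bmul hα.memLp (memLp_zpow k))
            (A (P θ (zpow 0))), coeFn_bmul α hα.memLp (zpow k),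
          coeFn_bmul (zpow k) (memLp_zpow k) (A (P θ (zpow 0))),
          coeFn_bmul α hα.memLp (bmul (zpow k) (memLp_zpow k) (A (P θ (zpow 0))))]
          with x h1 h2 h3 h4
        rw [h1, h2, h4, h3, mul_assoc]
      have h0 : inner ℂ w (hα.mul (zpow k)) = 0 := by
        rw [hw _ (memLp_bmul hα.memLp (memLp_zpow k)), inner_P_left, P_eq_zero_of_mem_mulH2 hmem,
          ZeroMemClass.coe_zero, inner_zero_right]
      exact h0
    · have h0 : inner ℂ w u = 0 := by
        rw [hw' (hθ.mulH2_le_H2 hu), P_eq_zero_of_mem_mulH2 hu, map_zero,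
          ZeroMemClass.coe_zero, inner_zero_right]
      exact h0
  exact Submodule.topologicalClosure_minimal _ hle (innerSL ℂ w : L2 →L[ℂ] ℂ).isClosed_ker
    (hγ.mem_closure hα hθ)

/-! ### The symbol space `(α / γ) K_γ` -/

theorem mem_quotMulK_of_mul_mem {γ ψ : L2} (hα : IsInner α) (hγ : IsInner γ)
    (hγα : InnerDvd γ α) (hψ : ψ ∈ K α) (h : hγ.mul ψ ∈ mulH2 α) : ψ ∈ quotMulK α γ := by
  obtain ⟨k, hk, hψk⟩ := hα.mem_mulH2.mp h
  obtain ⟨a, ha, hαa⟩ := hγα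
  have hne : ∀ᵐ x ∂m, γ x ≠ 0 := by
    filter_upwards [hγ.2] with x h1 h2
    simp [h2] at h1
  have hak : ψ = ha.mul k := by
    apply Lp.ext
    have h0 : ∀ᵐ x ∂m, hγ.mul ψ x = hα.mul k x := .of_forall fun x => by rw [hψk]
    filter_upwards [h0, hne, hαa, coeFn_bmul γ hγ.memLp ψ, coeFn_bmul α hα.memLp k,
      coeFn_bmul a ha.memLp k] with x h1 h2 h3 h4 h5 h6
    rw [h4, h5, h3, mul_assoc] at h1
    rw [h6, mul_left_cancel₀ h2 h1]
  refine ⟨k, ⟨hk, ?_⟩, ?_⟩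
  · -- `k ⊥ γ H²` because `ψ = a k` is orthogonal to `a γ H² = α H²`.
    intro u hu
    obtain ⟨v, hv, rfl⟩ := hγ.mem_mulH2.mp hu
    have h1 : ha.mul (hγ.mul v) = hα.mul v := by
      apply Lp.ext
      filter_upwards [hαa, coeFn_bmul γ hγ.memLp v, coeFn_bmul α hα.memLp v,
        coeFn_bmul a ha.memLp (hγ.mul v)] with x h1 h2 h3 h4
      rw [h4, h2, h3, h1]
      ring
    rw [← ha.inner_mul_mul, ← hak, h1]
    exact hψ.2 _ (hα.mul_mem_mulH2 hv)
  · rw [hak]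
    filter_upwards [hne, hαa, coeFn_bmul a ha.memLp k] with x h1 h2 h3
    rw [h3, h2, mul_div_cancel_left₀ _ h1]

theorem mem_H2_and_mul_mem_of_mem_quotMulK {γ φ : L2} (hα : IsInner α) (hθ : IsInner θ)
    (hγ : IsInner γ) (hγα : InnerDvd γ α) (hγθ : InnerDvd γ θ) (hφ : φ ∈ quotMulK α γ) :
    φ ∈ H2 ∧ hθ.mul φ ∈ mulH2 α := by
  obtain ⟨k, hk, hφk⟩ := hφ
  obtain ⟨a, ha, hαa⟩ := hγα
  obtain ⟨b, hb, hθb⟩ := hγθ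
  have hak : φ = ha.mul k := by
    apply Lp.ext
    filter_upwards [hφk, hγ.2, hαa, coeFn_bmul a ha.memLp k] with x h1 h2 h3 h4
    have h5 : γ x ≠ 0 := fun h => by simp [h] at h2
    rw [h1, h4, h3, mul_div_cancel_left₀ _ h5]
  refine ⟨hak ▸ ha.mul_mem_H2 (K_le_H2 γ hk), hα.mem_mulH2.mpr
    ⟨hb.mul k, hb.mul_mem_H2 (K_le_H2 γ hk), ?_⟩⟩
  rw [hak]
  apply Lp.ext
  filter_upwards [hαa, hθb, coeFn_bmul a ha.memLp k, coeFn_bmul b hb.memLp k,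
    coeFn_bmul θ hθ.memLp (ha.mul k), coeFn_bmul α hα.memLp (hb.mul k)] with x h1 h2 h3 h4 h5 h6
  rw [h5, h3, h6, h4, h1, h2]
  ring

end ModelSpace

theorem theorem3 (α θ : ModelSpace.L2)
    (hα : ModelSpace.IsInner α) (hα' : ¬ ModelSpace.IsConst α)
    (hθ : ModelSpace.IsInner θ) (hθ' : ¬ ModelSpace.IsConst θ)
    (A : ModelSpace.K θ →L[ℂ] ModelSpace.K α) :
    (∃ γ : ModelSpace.L2, ModelSpace.IsInnerGCD γ α θ) ∧
    ∀ γ : ModelSpace.L2, ModelSpace.IsInnerGCD γ α θ →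
      (ModelSpace.S α ∘L A = A ∘L ModelSpace.S θ ↔
        A ∈ ModelSpace.ATTO θ α ∧
          ∃ φ ∈ ModelSpace.quotMulK α γ, ModelSpace.HasSymbol A φ) := by
  refine ⟨ModelSpace.exists_isInnerGCD hα hθ, fun γ hγ => ⟨fun hA => ?_, ?_⟩⟩
  · have hsymb := ModelSpace.hasSymbol_of_intertwines hθ hα hA
    exact ⟨⟨_, hsymb⟩, _, ModelSpace.mem_quotMulK_of_mul_mem hα hγ.1 hγ.2.1 (A _).2
      (ModelSpace.gcd_mul_mem_mulH2_of_intertwines hθ hα hA hγ), hsymb⟩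
  · rintro ⟨-, φ, hφ, hsymb⟩
    obtain ⟨h1, h2⟩ :=
      ModelSpace.mem_H2_and_mul_mem_of_mem_quotMulK hα hθ hγ.1 hγ.2.1 hγ.2.2.1 hφ
    exact hsymb.intertwines hθ hα h1 h2
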